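/- Let $\mathbb{K}\in\{\mathbb{R},\mathbb{C}\}$, let $\Omega$ be a Hausdorff space and let $(\mathcal{F},\|\cdot\|)$ be a normed space over $\mathbb{K}$ with $\mathcal{F}\subset\mathcal{C}(\Omega)$ (a linear subspace), where $\mathcal{C}(\Omega)$ is the space of continuous functions $\Omega\to\mathbb{K}$. Let $\tau_{\mathrm{co}}$ be the topology induced on $\mathcal{F}$ by the compact-open topology. Assume that $(\mathcal{F},\|\cdot\|,\tau_{\mathrm{co}})$ is a Saks space, i.e. $\tau_{\mathrm{co}}$ is coarser than the norm topology and is generated by a directed system $\Gamma$ of seminorms such that $\|f\|=\sup_{p\in\Gamma}p(f)$ for all $f\in\mathcal{F}$. Let $\gamma$ be the mixed topology, i.e. the finest linear topology on $\mathcal{F}$ that lies between $\tau_{\mathrm{co}}$ and the norm topology and coincides with $\tau_{\mathrm{co}}$ on norm-bounded sets, and assume that $(\mathcal{F},\gamma)$ is sequentially complete. Let $(m,\varphi)$ be a jointly continuous co-semiflow for $\mathcal{F}$. That is: $\varphi_t\colon\Omega\to\Omega$ and $m_t\colon\Omega\to\mathbb{K}$ ($t\ge 0$) are such that $(t,x)\mapsto\varphi_t(x)$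 and $(t,x)\mapsto m_t(x)$ are continuous on $[0,\infty)\times\Omega$; for all $t,s\ge 0$ and $x\in\Omega$ one has $\varphi_0(x)=x$, $\varphi_{t+s}(x)=\varphi_t(\varphi_s(x))$, $m_0(x)=1$, $m_{t+s}(x)=m_t(x)\,m_s(\varphi_t(x))$; and $C_{m,\varphi}(t)f:=m_t\cdot(f\circ\varphi_t)\in\mathcal{F}$ for all $t\ge 0$ and $f\in\mathcal{F}$. Let $(A,D(A))$ be the $\gamma$-generator of the semigroup $(C_{m,\varphi}(t))_{t\ge 0}$ on $\mathcal{F}$, $$D(A)=\Bigl\{f\in\mathcal{F}\;\Big|\;\gamma\text{-}\lim_{t\to 0+}\tfrac{C_{m,\varphi}(t)f-f}{t}\text{ exists in }\mathcal{F}\Bigr\},\qquad Af=\gamma\text{-}\lim_{t\to 0+}\tfrac{C_{m,\varphi}(t)f-f}{t},$$ and let $(A_{\|\cdot\|},D(A_{\|\cdot\|}))$ be the norm-generator, defined in the same way with norm limits. Call the semigroup norm-strongly continuous if every $C_{m,\varphi}(t)$ is norm-continuous and $t\mapsto C_{m,\varphi}(t)f$ is norm-continuous on $[0,\infty)$ for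 every $f\in\mathcal{F}$, and locally bounded if $\sup_{t\in[0,t_0]}\|C_{m,\varphi}(t)\|_{\mathcal{L}(\mathcal{F})}<\infty$ for all $t_0\ge 0$. Then the following hold. (a) If $(C_{m,\varphi}(t))_{t\ge 0}$ is norm-strongly continuous, then $D(A)=D(A_{\|\cdot\|})$ and $A=A_{\|\cdot\|}$. (b) If $(\mathcal{F},\|\cdot\|)$ is reflexive and $(C_{m,\varphi}(t))_{t\ge 0}$ is locally bounded, then $(C_{m,\varphi}(t))_{t\ge 0}$ is norm-strongly continuous. (c) If $(C_{m,\varphi}(t))_{t\ge 0}$ is locally bounded, then $$\Bigl\{f\in\mathcal{F}\;\Big|\;\|\cdot\|\text{-}\lim_{t\to 0+}C_{m,\varphi}(t)f=f\Bigr\}=\overline{D(A)}^{\|\cdot\|},$$ the closure being taken in the norm topology. -/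

import Mathlib

open Filter Topology
open scoped NNReal

namespace Saks

section Spaces

/-- The norm topology of a normed space. -/
def normTopology (X : Type*) [NormedAddCommGroup X] : TopologicalSpace X :=
  UniformSpace.toTopologicalSpace

variable (𝕜 : Type*) [RCLike 𝕜] {X : Type*} [NormedAddCommGroup X] [NormedSpace 𝕜 X]

/-- `τ` is a linear (i.e. vector space) topology on `X`. -/
structure IsLinearTopology (τ : TopologicalSpace X) : Prop where
  continuous_add : @ContinuousAdd X τ _
  continuous_smul : @ContinuousSMul 𝕜 X _ _ τ

/-- The triple `(X, ‖·‖, τ)` is a pre-Saks space: `τ` is a Hausdorff locally convex topology on the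
normed space `X` (local convexity means: generated by a family of seminorms) that is coarser than
the norm topology. -/
structure IsPreSaks (τ : TopologicalSpace X) : Prop where
  t2 : @T2Space X τ
  locallyConvex : ∃ Γ : Set (Seminorm 𝕜 X), WithSeminorms (topology := τ) (fun p : Γ => p.1)
  coarser : normTopology X ≤ τ

/-- A pre-Saks space is a Saks space if `τ` is generated by a directed system `Γ` of seminorms
such that `‖x‖ = sup_{p ∈ Γ} p x` for all `x`. -/
structure IsSaks (τ : TopologicalSpace X) : Prop extends IsPreSaks 𝕜 τ where
  exists_norming : ∃ Γ : Set (Seminorm 𝕜 X), DirectedOn (· ≤ ·) Γ ∧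
    WithSeminorms (topology := τ) (fun p : Γ => p.1) ∧
    ∀ x : X, IsLUB ((fun p : Seminorm 𝕜 X => p x) '' Γ) ‖x‖

/-- The linear topologies `t` between `τ` and the norm topology that coincide with `τ` on all
norm-bounded sets. -/
def mixedCandidates (τ : TopologicalSpace X) : Set (TopologicalSpace X) :=
  {t | IsLinearTopology 𝕜 t ∧
    (∀ B : Set X, Bornology.IsBounded B →
      TopologicalSpace.induced ((↑) : B → X) t = TopologicalSpace.induced ((↑) : B → X) τ) ∧
    normTopology X ≤ t ∧ t ≤ τ}

/-- The mixed topology `γ(‖·‖, τ)`: the finest linear topology between `τ` and the norm topology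
that coincides with `τ` on norm-bounded sets (see `isLeast_mixedTopology`; in Mathlib's order on
topologies `t ≤ t'` means that `t` is finer than `t'`). -/
def mixedTopology (τ : TopologicalSpace X) : TopologicalSpace X :=
  sInf (mixedCandidates 𝕜 τ)

variable {𝕜}

theorem IsPreSaks.isLinearTopology {τ : TopologicalSpace X} (h : IsPreSaks 𝕜 τ) :
    IsLinearTopology 𝕜 τ := by
  obtain ⟨Γ, hΓ⟩ := h.locallyConvex
  let _ := τ
  have := hΓ.topologicalAddGroup
  exact ⟨inferInstance, hΓ.continuousSMul⟩

/-- On a pre-Saks space the mixed topology is indeed the finest one with the defining property. -/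
theorem isLeast_mixedTopology {τ : TopologicalSpace X} (h : IsPreSaks 𝕜 τ) :
    IsLeast (mixedCandidates 𝕜 τ) (mixedTopology 𝕜 τ) := by
  have hτ : τ ∈ mixedCandidates 𝕜 τ :=
    ⟨h.isLinearTopology, fun _ _ => rfl, h.coarser, le_rfl⟩
  refine ⟨⟨⟨?_, ?_⟩, ?_, ?_, ?_⟩, fun t ht => sInf_le ht⟩
  · exact continuousAdd_sInf fun t ht => ht.1.1
  · exact continuousSMul_sInf fun t ht => ht.1.2
  · intro B hB
    refine le_antisymm (induced_mono (sInf_le hτ)) ?_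
    rw [mixedTopology, induced_sInf]
    refine le_sInf ?_
    rintro _ ⟨t, ht, rfl⟩
    exact (ht.2.1 B hB).ge
  · exact le_sInf fun t ht => ht.2.2.1
  · exact sInf_le hτ

theorem t2Space_mixedTopology {τ : TopologicalSpace X} (h : IsPreSaks 𝕜 τ) :
    @T2Space X (mixedTopology 𝕜 τ) :=
  @T2Space.of_injective_continuous X X (mixedTopology 𝕜 τ) τ h.t2 id Function.injective_id
    (continuous_id_iff_le.2 (isLeast_mixedTopology h).1.2.2.2)

variable (𝕜)

/-- Sequential completeness of a linear topology `t`: every `t`-Cauchy sequence `t`-converges. -/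
def IsSeqComplete (t : TopologicalSpace X) : Prop :=
  ∀ u : ℕ → X,
    (∀ U ∈ @nhds X t 0, ∃ N : ℕ, ∀ i ≥ N, ∀ j ≥ N, u i - u j ∈ U) →
    ∃ x : X, Tendsto u atTop (@nhds X t x)

/-- A normed space is reflexive if the canonical embedding into its bidual is onto. -/
def IsReflexiveSpace (X : Type*) [NormedAddCommGroup X] [NormedSpace 𝕜 X] : Prop :=
  Function.Surjective (NormedSpace.inclusionInDoubleDual 𝕜 X)

end Spaces

section Semigroups

variable {𝕜 : Type*} [RCLike 𝕜] {X : Type*} [NormedAddCommGroup X] [NormedSpace 𝕜 X]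

/-- Strong continuity, with respect to the topology `t` on `X`, of a family `(T s)_{s ≥ 0}` of
linear maps: every `T s` is `t`-continuous and every orbit `s ↦ T s x` is `t`-continuous. -/
def IsStronglyContinuous (t : TopologicalSpace X) (T : ℝ≥0 → X →ₗ[𝕜] X) : Prop :=
  (∀ s, @Continuous X X t t (T s)) ∧ ∀ x, @Continuous ℝ≥0 X _ t (fun s => T s x)

/-- `sup_{s ∈ [0, t₀]} ‖T s‖ < ∞` for all `t₀ ≥ 0`. -/
def IsLocallyBounded (T : ℝ≥0 → X →ₗ[𝕜] X) : Prop :=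
  ∀ t₀ : ℝ≥0, ∃ M : ℝ, ∀ s ≤ t₀, ∀ x, ‖T s x‖ ≤ M * ‖x‖

/-- The limit of `(T s x - x) / s` as `s → 0+`, with respect to the topology `t`, equals `y`. -/
def HasGeneratorValue (t : TopologicalSpace X) (T : ℝ≥0 → X →ₗ[𝕜] X) (x y : X) : Prop :=
  Tendsto (fun s : ℝ≥0 => (((s : ℝ) : 𝕜)⁻¹) • (T s x - x)) (𝓝[>] 0) (@nhds X t y)

/-- The domain of the generator of `T` with respect to the topology `t`. -/
def generatorDomain (t : TopologicalSpace X) (T : ℝ≥0 → X →ₗ[𝕜] X) : Set X :=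
  {x | ∃ y, HasGeneratorValue t T x y}

/-- The generator of `T` with respect to the topology `t`, as a map on its domain. -/
noncomputable def generator (t : TopologicalSpace X) (T : ℝ≥0 → X →ₗ[𝕜] X)
    (x : generatorDomain t T) : X :=
  x.2.choose

/-- For a Hausdorff topology the generator is the limit of the difference quotients. -/
theorem generator_eq_iff {t : TopologicalSpace X} (ht : @T2Space X t) {T : ℝ≥0 → X →ₗ[𝕜] X}
    (x : generatorDomain t T) (y : X) :
    generator t T x = y ↔ HasGeneratorValue t T x y := by
  constructor
  · rintro rfl
    exact x.2.choose_spec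
  · intro h
    exact @tendsto_nhds_unique X ℝ≥0 t ht _ _ _ _ _ x.2.choose_spec h

/-- The space of norm-strong continuity `{x | ‖·‖-lim_{s → 0+} T s x = x}`. -/
def strongContinuitySpace (T : ℝ≥0 → X →ₗ[𝕜] X) : Set X :=
  {x | Tendsto (fun s => T s x) (𝓝[>] 0) (@nhds X (normTopology X) x)}

end Semigroups

section WeightedComposition

variable {𝕜 : Type*} [RCLike 𝕜] {Ω : Type*} [TopologicalSpace Ω]

/-- A semiflow on `Ω`. -/
structure IsSemiflow (φ : ℝ≥0 → Ω → Ω) : Prop where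
  continuous : ∀ t, Continuous (φ t)
  zero : ∀ x, φ 0 x = x
  add : ∀ t s x, φ (t + s) x = φ t (φ s x)

/-- A multiplicative semicocycle for `φ`. -/
structure IsSemicocycle (φ : ℝ≥0 → Ω → Ω) (m : ℝ≥0 → Ω → 𝕜) : Prop where
  continuous : ∀ t, Continuous (m t)
  zero : ∀ x, m 0 x = 1
  add : ∀ t s x, m (t + s) x = m t x * m s (φ t x)

/-- `(m, φ)` is a co-semiflow: `φ` is a semiflow and `m` a semicocycle for `φ`. -/
structure IsCoSemiflow (m : ℝ≥0 → Ω → 𝕜) (φ : ℝ≥0 → Ω → Ω) : Prop where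
  semiflow : IsSemiflow φ
  semicocycle : IsSemicocycle φ m

/-- Joint continuity of `(m, φ)`. -/
structure IsJointlyContinuous (m : ℝ≥0 → Ω → 𝕜) (φ : ℝ≥0 → Ω → Ω) : Prop where
  semiflow : Continuous fun p : ℝ≥0 × Ω => φ p.1 p.2
  semicocycle : Continuous fun p : ℝ≥0 × Ω => m p.1 p.2

variable {F : Type*} [NormedAddCommGroup F] [NormedSpace 𝕜 F]

/-- The topology induced on `F` by the compact-open topology of `C(Ω, 𝕜)` along the inclusion
`ι : F → C(Ω, 𝕜)`. -/
def compactOpenTopology (ι : F →ₗ[𝕜] C(Ω, 𝕜)) : TopologicalSpace F :=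
  TopologicalSpace.induced ι ContinuousMap.compactOpen

/-- The mixed topology `γ(‖·‖, τ_co)` on `F`. -/
def gammaTopology (ι : F →ₗ[𝕜] C(Ω, 𝕜)) : TopologicalSpace F :=
  mixedTopology 𝕜 (compactOpenTopology ι)

/-- The co-semiflow `(m, φ)` is a co-semiflow for the function space `F` (included in `C(Ω, 𝕜)` by
`ι`): for all `f ∈ F` and `t ≥ 0` the function `m_t · (f ∘ φ_t)` belongs to `F`. -/
structure IsCoSemiflowFor (ι : F →ₗ[𝕜] C(Ω, 𝕜)) (m : ℝ≥0 → Ω → 𝕜) (φ : ℝ≥0 → Ω → Ω) : Prop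
    extends IsCoSemiflow m φ where
  exists_mem : ∀ t f, ∃ g : F, ∀ x, ι g x = m t x * ι f (φ t x)

/-- The weighted composition semigroup `C_{m,φ}(t) f = m_t · (f ∘ φ_t)` on `F`. -/
noncomputable def weightedComp {ι : F →ₗ[𝕜] C(Ω, 𝕜)} (hι : Function.Injective ι)
    {m : ℝ≥0 → Ω → 𝕜} {φ : ℝ≥0 → Ω → Ω} (h : IsCoSemiflowFor ι m φ) (t : ℝ≥0) :
    F →ₗ[𝕜] F where
  toFun f := (h.exists_mem t f).choose
  map_add' f g := hι <| ContinuousMap.ext fun x => by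
    rw [(h.exists_mem t (f + g)).choose_spec x, map_add, map_add, ContinuousMap.add_apply,
      ContinuousMap.add_apply, (h.exists_mem t f).choose_spec x,
      (h.exists_mem t g).choose_spec x, mul_add]
  map_smul' c f := hι <| ContinuousMap.ext fun x => by
    rw [(h.exists_mem t (c • f)).choose_spec x, map_smul, RingHom.id_apply, map_smul,
      ContinuousMap.smul_apply, ContinuousMap.smul_apply, (h.exists_mem t f).choose_spec x,
      smul_eq_mul, smul_eq_mul, mul_left_comm]

theorem weightedComp_apply {ι : F →ₗ[𝕜] C(Ω, 𝕜)} (hι : Function.Injective ι)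
    {m : ℝ≥0 → Ω → 𝕜} {φ : ℝ≥0 → Ω → Ω} (h : IsCoSemiflowFor ι m φ) (t : ℝ≥0) (f : F) (x : Ω) :
    ι (weightedComp hι h t f) x = m t x * ι f (φ t x) :=
  (h.exists_mem t f).choose_spec x

end WeightedComposition

end Saks

/-!
The compact-open topology `τ` of the function space is coarser than the mixed topology `γ`, and the
weighted composition semigroup `T` is `τ`-strongly continuous. A `γ`-generator value is therefore a
`τ`-generator value, and everything is deduced from the coarse topology `τ`.

The central tool is a mean value inequality for orbits (`seminorm_orbit_sub_le`). If `g` is the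
`τ`-generator value of `f`, then `s ↦ T s f` has right `τ`-derivative `T s g`; hence for a
`τ`-continuous seminorm `p` a bound `p (T s g - c) ≤ ε` on `[0, t)` gives
`p (T t f - f - t c) ≤ ε t`. Since the norm of a Saks space is a supremum of `τ`-continuous
seminorms, the same holds with `p` replaced by the norm (`IsSaks.norm_orbit_sub_le`).

* With `c = g` this shows that the difference quotients of `f` converge to `g` in norm as soon as
  the orbit of `g` is norm continuous at `0` (`IsSaks.hasGeneratorValue_norm`), so that the
  `γ`-generator and the norm generator of a norm-strongly continuous semigroup agree.
* With `c = 0` and local boundedness it shows that the domain of the generator lies in the space of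
  norm-strong continuity, which is norm closed. Conversely, the norm is complete because `γ` is
  sequentially complete (`IsSaks.completeSpace`), so an element `f` of the space of strong
  continuity is the norm limit of the integral means `t⁻¹ ∫₀ᵗ T s f ds`, which lie in the domain
  (`IsLocallyBounded.strongContinuitySpace_subset_closure`).
* In the reflexive case the point evaluations span a norm dense subspace of the dual, so bounded
  orbits are weakly continuous (`IsReflexiveSpace.continuous_dual_apply`). The means of an orbit
  then exist as weak integrals by reflexivity, they lie in the space of strong continuity, and they
  converge weakly to the initial value; as this space is a closed subspace, the Hahn-Banach theorem
  puts every vector into it (`IsLocallyBounded.mem_strongContinuitySpace_of_weak`).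
-/

namespace Saks

/-! ### Fencing estimate along orbits -/

section Fencing

variable {𝕜 : Type*} [RCLike 𝕜] {E : Type*} [AddCommGroup E] [Module 𝕜 E] [TopologicalSpace E]
  [IsTopologicalAddGroup E] [ContinuousSMul 𝕜 E]

theorem tendsto_toNNReal_sub_nhdsGT (s : ℝ) :
    Tendsto (fun z : ℝ => (z - s).toNNReal) (𝓝[>] s) (𝓝[>] 0) := by
  refine tendsto_nhdsWithin_iff.2 ⟨?_, ?_⟩
  · have : Continuous fun z : ℝ => (z - s).toNNReal := by fun_prop
    simpa using (this.tendsto s).mono_left nhdsWithin_le_nhds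
  · filter_upwards [self_mem_nhdsWithin] with z hz
    simpa using hz

/-- The orbit `s ↦ T s f` has right derivative `T s g`. If this derivative stays `ε`-close to `c`
with respect to a continuous seminorm, then the orbit is `ε t`-close to `f + t c` at time `t`. -/
theorem seminorm_orbit_sub_le {T : ℝ≥0 → E →ₗ[𝕜] E}
    (hT0 : ∀ x, T 0 x = x) (hTadd : ∀ s h x, T (s + h) x = T s (T h x))
    (hTc : ∀ s, Continuous (T s)) (hTo : ∀ x, Continuous fun s => T s x)
    {p : Seminorm 𝕜 E} (hp : Continuous p) {f g c : E}
    (hfg : Tendsto (fun s : ℝ≥0 => (((s : ℝ) : 𝕜)⁻¹) • (T s f - f)) (𝓝[>] 0) (𝓝 g))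
    {t : ℝ≥0} {ε : ℝ} (hε : ∀ s < t, p (T s g - c) ≤ ε) :
    p (T t f - f - ((t : ℝ) : 𝕜) • c) ≤ ε * t := by
  set u : ℝ → E := fun s => T s.toNNReal f - f - (s : 𝕜) • c with hu
  have hcont : Continuous fun s : ℝ => p (u s) := by
    have h1 : Continuous fun s : ℝ => T s.toNNReal f := (hTo f).comp continuous_real_toNNReal
    have h2 : Continuous fun s : ℝ => (s : 𝕜) • c :=
      RCLike.continuous_ofReal.smul continuous_const
    exact hp.comp ((h1.sub continuous_const).sub h2)
  have key := image_le_of_liminf_slope_right_le_deriv_boundary (f := fun s => p (u s)) (a := 0)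
    (b := (t : ℝ)) (B := fun s => ε * s) (B' := fun _ => ε) hcont.continuousOn
    (by simp [hu, hT0]) (by fun_prop)
    (fun x _ => by simpa using ((hasDerivAt_id x).const_mul ε).hasDerivWithinAt) ?_
    (Set.right_mem_Icc.2 t.2)
  · simpa [hu] using key
  rintro s ⟨hs0, hst⟩ r hr
  have hlim : Tendsto (fun h : ℝ≥0 => p (T s.toNNReal ((((h : ℝ) : 𝕜)⁻¹) • (T h f - f)) - c))
      (𝓝[>] 0) (𝓝 (p (T s.toNNReal g - c))) := by
    have : Continuous fun y => p (T s.toNNReal y - c) :=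
      hp.comp ((hTc _).sub continuous_const)
    exact (this.tendsto g).comp hfg
  have hlt : p (T s.toNNReal g - c) < r :=
    (hε _ ((Real.toNNReal_lt_iff_lt_coe hs0).2 hst)).trans_lt hr
  have hev := (hlim.comp (tendsto_toNNReal_sub_nhdsGT s)).eventually_lt_const hlt
  refine Eventually.frequently ?_
  filter_upwards [hev, self_mem_nhdsWithin] with z hz hsz
  have hpos : 0 < z - s := sub_pos.2 hsz
  refine lt_of_le_of_lt ?_ hz
  have hne : ((z - s : ℝ) : 𝕜) ≠ 0 := RCLike.ofReal_ne_zero.2 hpos.ne'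
  have hz' : z.toNNReal = s.toNNReal + (z - s).toNNReal := by
    rw [← Real.toNNReal_add hs0 hpos.le, add_sub_cancel]
  have huz : u z - u s = ((z - s : ℝ) : 𝕜) •
      (T s.toNNReal ((((z - s : ℝ) : 𝕜)⁻¹) • (T (z - s).toNNReal f - f)) - c) := by
    simp only [hu]
    rw [map_smul, smul_sub, smul_smul, mul_inv_cancel₀ hne, one_smul, map_sub, ← hTadd, ← hz',
      RCLike.ofReal_sub, sub_smul]
    abel
  simp only [Function.comp, Real.coe_toNNReal _ hpos.le]
  rw [slope_def_field, div_le_iff₀ hpos]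
  calc p (u z) - p (u s) ≤ p (u z - u s) := (le_abs_self _).trans (abs_sub_map_le_sub p _ _)
    _ = _ := by
      rw [huz, map_smul_eq_mul, RCLike.norm_ofReal, abs_of_pos hpos, mul_comm]

end Fencing

/-! ### Norm estimates in Saks spaces -/

section Saks

variable {𝕜 : Type*} [RCLike 𝕜] {X : Type*} {t τ : TopologicalSpace X} [NormedAddCommGroup X]
  [NormedSpace 𝕜 X]

/-- The fencing estimate in norm for a semigroup that is strongly continuous with respect to the
coarse topology `τ` of a Saks space: it passes from the seminorms to their supremum. -/
theorem IsSaks.norm_orbit_sub_le (h : IsSaks 𝕜 τ) {T : ℝ≥0 → X →ₗ[𝕜] X}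
    (hT0 : ∀ x, T 0 x = x) (hTadd : ∀ s h x, T (s + h) x = T s (T h x))
    (hT : IsStronglyContinuous τ T) {f g c : X} (hfg : HasGeneratorValue τ T f g)
    {t : ℝ≥0} {ε : ℝ} (hε : ∀ s < t, ‖T s g - c‖ ≤ ε) :
    ‖T t f - f - ((t : ℝ) : 𝕜) • c‖ ≤ ε * t := by
  obtain ⟨Γ, -, hΓ, hlub⟩ := h.exists_norming
  refine (hlub _).2 ?_
  rintro _ ⟨p, hp, rfl⟩
  refine @seminorm_orbit_sub_le 𝕜 _ X _ _ τ hΓ.topologicalAddGroup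
    hΓ.continuousSMul T hT0 hTadd hT.1 hT.2 p
    (hΓ.continuous_seminorm ⟨p, hp⟩) f g c hfg t ε
    fun s hs => ((hlub _).1 ⟨p, hp, rfl⟩).trans (hε s hs)

theorem HasGeneratorValue.mono (h : t ≤ τ) {T : ℝ≥0 → X →ₗ[𝕜] X}
    {x y : X} (hxy : HasGeneratorValue t T x y) : HasGeneratorValue τ T x y :=
  hxy.mono_right (_root_.nhds_mono h)

/-- A `τ`-limit of the difference quotients of `f` at which the semigroup is norm continuous is
already a norm limit. -/
theorem IsSaks.hasGeneratorValue_norm (h : IsSaks 𝕜 τ) {T : ℝ≥0 → X →ₗ[𝕜] X}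
    (hT0 : ∀ x, T 0 x = x) (hTadd : ∀ s h x, T (s + h) x = T s (T h x))
    (hT : IsStronglyContinuous τ T) {f g : X} (hfg : HasGeneratorValue τ T f g)
    (hg : g ∈ strongContinuitySpace T) : HasGeneratorValue (normTopology X) T f g := by
  have hg' : Tendsto (fun s => T s g) (𝓝[>] 0) (@nhds X (normTopology X) g) := hg
  refine Metric.tendsto_nhds.2 fun ε hε => ?_
  have h1 := Metric.tendsto_nhds.1 hg' (ε / 2) (half_pos hε)
  rw [eventually_nhdsWithin_iff, NNReal.nhds_zero_basis.eventually_iff] at h1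
  obtain ⟨δ, hδ, h1⟩ := h1
  filter_upwards [Ioo_mem_nhdsGT hδ] with t ht
  have hb : ∀ s < t, ‖T s g - g‖ ≤ ε / 2 := fun s hs => by
    rcases eq_or_ne s 0 with rfl | h0
    · rw [hT0, sub_self, norm_zero]
      exact (half_pos hε).le
    · rw [← dist_eq_norm]
      exact (h1 (hs.trans ht.2) (pos_iff_ne_zero.2 h0)).le
  have h2 := h.norm_orbit_sub_le hT0 hTadd hT hfg hb
  have htpos : (0 : ℝ) < t := ht.1
  have hne : ((t : ℝ) : 𝕜) ≠ 0 := RCLike.ofReal_ne_zero.2 htpos.ne'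
  have h3 : (((t : ℝ) : 𝕜)⁻¹) • (T t f - f) - g
      = (((t : ℝ) : 𝕜)⁻¹) • (T t f - f - ((t : ℝ) : 𝕜) • g) := by
    rw [smul_sub _ (T t f - f), smul_smul, inv_mul_cancel₀ hne, one_smul]
  rw [dist_eq_norm, h3, norm_smul, norm_inv, RCLike.norm_ofReal, abs_of_pos htpos,
    inv_mul_lt_iff₀ htpos]
  nlinarith

/-- Sequential completeness of a topology between `τ` and the norm topology makes the norm
complete, because the closed balls of a Saks space are `τ`-closed. -/
theorem IsSaks.completeSpace (h : IsSaks 𝕜 τ) (hnt : normTopology X ≤ t) (htτ : t ≤ τ)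
    (hc : IsSeqComplete t) : CompleteSpace X := by
  obtain ⟨Γ, -, hΓ, hlub⟩ := h.exists_norming
  refine Metric.complete_of_cauchySeq_tendsto fun u hu => ?_
  obtain ⟨x, hx⟩ := hc u fun U hU => by
    have hU' : U ∈ @nhds X (normTopology X) 0 := _root_.nhds_mono hnt hU
    obtain ⟨ε, hε, hεU⟩ := Metric.mem_nhds_iff.1 hU'
    obtain ⟨N, hN⟩ := Metric.cauchySeq_iff.1 hu ε hε
    refine ⟨N, fun i hi j hj => hεU ?_⟩
    simpa [dist_eq_norm] using hN i hi j hj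
  have hxτ : Tendsto u atTop (@nhds X τ x) := hx.mono_right (_root_.nhds_mono htτ)
  refine ⟨x, ?_⟩
  rw [Metric.tendsto_atTop]
  intro ε hε
  obtain ⟨N, hN⟩ := Metric.cauchySeq_iff.1 hu (ε / 2) (half_pos hε)
  refine ⟨N, fun n hn => ?_⟩
  refine lt_of_le_of_lt ?_ (half_lt_self hε)
  rw [dist_eq_norm]
  refine (hlub _).2 ?_
  rintro _ ⟨p, hp, rfl⟩
  have hpc : Tendsto (fun k => p (u n - u k)) atTop (𝓝 (p (u n - x))) := by
    have := hΓ.topologicalAddGroup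
    have hcont : @Continuous X ℝ τ _ fun y => p (u n - y) :=
      (hΓ.continuous_seminorm ⟨p, hp⟩).comp
        (continuous_const.sub continuous_id)
    exact ((@Continuous.tendsto _ _ τ _ _ hcont x)).comp hxτ
  refine le_of_tendsto hpc ?_
  filter_upwards [eventually_ge_atTop N] with k hk
  refine ((hlub _).1 ⟨p, hp, rfl⟩).trans ?_
  rw [← dist_eq_norm]
  exact (hN n hn k hk).le

end Saks

/-! ### Weak continuity in reflexive spaces -/

section Dual

variable {𝕜 : Type*} [RCLike 𝕜] {E : Type*} [NormedAddCommGroup E] [NormedSpace 𝕜 E]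

theorem exists_dual_ne_zero_of_notMem (M : Submodule 𝕜 E) (hM : IsClosed (M : Set E)) {x : E}
    (hx : x ∉ M) : ∃ l : StrongDual 𝕜 E, l x ≠ 0 ∧ ∀ y ∈ M, l y = 0 := by
  have : IsClosed (M : Set E) := hM
  have : IsClosed (M.toAddSubgroup : Set E) := hM
  obtain ⟨l, hl⟩ := SeparatingDual.exists_ne_zero (R := 𝕜) (V := E ⧸ M) (x := M.mkQ x)
    (by simpa using hx)
  refine ⟨l.comp M.mkQL, hl, fun y hy => ?_⟩
  have : M.mkQ y = 0 := by simpa using hy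
  show l (M.mkQ y) = 0
  rw [this, map_zero]

/-- In a reflexive space a locally bounded curve is weakly continuous as soon as its composition
with each member of a point-separating family of functionals is continuous: by reflexivity the
span of such a family is norm dense in the dual. -/
theorem IsReflexiveSpace.continuous_dual_apply (hE : IsReflexiveSpace 𝕜 E)
    {D : Set (StrongDual 𝕜 E)} (hD : ∀ x : E, (∀ d ∈ D, d x = 0) → x = 0)
    {Y : Type*} [TopologicalSpace Y] {u : Y → E} (hu : ∀ y, ∃ M, ∀ᶠ z in 𝓝 y, ‖u z‖ ≤ M)
    (hDu : ∀ d ∈ D, Continuous fun y => d (u y)) (l : StrongDual 𝕜 E) :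
    Continuous fun y => l (u y) := by
  let L : Submodule 𝕜 (StrongDual 𝕜 E) :=
    { carrier := {l | Continuous fun y => l (u y)}
      add_mem' := fun {a b} ha hb => Continuous.add ha hb
      zero_mem' := continuous_const
      smul_mem' := fun c a ha => Continuous.const_smul ha c }
  have hL : IsClosed (L : Set (StrongDual 𝕜 E)) := by
    refine isClosed_of_closure_subset fun l hl => ?_
    refine continuous_of_locally_uniform_approx_of_continuousAt fun y U hU => ?_
    obtain ⟨ε, hε, hεU⟩ := Metric.mem_uniformity_dist.1 hU
    obtain ⟨M, hM⟩ := hu y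
    have hM1 : 0 < |M| + 1 := by positivity
    obtain ⟨l', hl', hd⟩ := Metric.mem_closure_iff.1 hl (ε / (|M| + 1)) (by positivity)
    refine ⟨_, hM, fun z => l' (u z), (show Continuous _ from hl').continuousAt,
      fun z hz => hεU ?_⟩
    rw [dist_eq_norm] at hd ⊢
    calc ‖l (u z) - l' (u z)‖ = ‖(l - l') (u z)‖ := rfl
      _ ≤ ‖l - l'‖ * ‖u z‖ := (l - l').le_opNorm _
      _ ≤ ‖l - l'‖ * (|M| + 1) := by
        gcongr
        exact (show ‖u z‖ ≤ M from hz).trans ((le_abs_self M).trans (lt_add_one _).le)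
      _ < ε := by rwa [lt_div_iff₀ hM1] at hd
  by_contra hl
  obtain ⟨Φ, hΦ, hΦL⟩ := exists_dual_ne_zero_of_notMem L hL (x := l) hl
  obtain ⟨x, rfl⟩ := hE Φ
  exact hΦ (by simp [hD x fun d hd => by simpa using hΦL d (hDu d hd)])

end Dual

/-! ### Locally bounded semigroups on normed spaces -/

section LocallyBounded

variable {𝕜 : Type*} [RCLike 𝕜] {X : Type*} [NormedAddCommGroup X] [NormedSpace 𝕜 X]
  {T : ℝ≥0 → X →ₗ[𝕜] X}

theorem IsLocallyBounded.exists_nonneg (hT : IsLocallyBounded T) (t₀ : ℝ≥0) :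
    ∃ M : ℝ, 0 ≤ M ∧ ∀ s ≤ t₀, ∀ x, ‖T s x‖ ≤ M * ‖x‖ := by
  obtain ⟨M, hM⟩ := hT t₀
  refine ⟨|M|, abs_nonneg M, fun s hs x => (hM s hs x).trans ?_⟩
  gcongr
  exact le_abs_self M

theorem IsLocallyBounded.continuous (hT : IsLocallyBounded T) (s : ℝ≥0) : Continuous (T s) := by
  obtain ⟨M, hM⟩ := hT s
  exact AddMonoidHomClass.continuous_of_bound (T s) M (hM s le_rfl)

theorem mem_strongContinuitySpace_iff (hT0 : ∀ x, T 0 x = x) {x : X} :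
    x ∈ strongContinuitySpace T ↔ ContinuousAt (fun s => T s x) 0 := by
  have h0 : Set.Ioi (0 : ℝ≥0) = {0}ᶜ := by
    ext s
    simp [pos_iff_ne_zero]
  rw [continuousAt_iff_punctured_nhds, hT0, ← h0]
  rfl

/-- The space of norm-strong continuity as a linear subspace. -/
def strongContinuitySubmodule (hT0 : ∀ x, T 0 x = x) : Submodule 𝕜 X where
  carrier := strongContinuitySpace T
  add_mem' {x y} hx hy := by
    rw [mem_strongContinuitySpace_iff hT0] at *
    simp only [map_add]
    exact hx.add hy
  zero_mem' := by
    rw [mem_strongContinuitySpace_iff hT0]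
    simpa using continuousAt_const
  smul_mem' c x hx := by
    rw [mem_strongContinuitySpace_iff hT0] at *
    simp only [map_smul]
    exact hx.const_smul c

theorem IsLocallyBounded.isClosed_strongContinuitySpace (hT : IsLocallyBounded T)
    (hT0 : ∀ x, T 0 x = x) : IsClosed (strongContinuitySpace T) := by
  refine isClosed_of_closure_subset fun x hx => ?_
  rw [mem_strongContinuitySpace_iff hT0]
  refine continuousAt_of_locally_uniform_approx_of_continuousAt fun U hU => ?_
  obtain ⟨ε, hε, hεU⟩ := Metric.mem_uniformity_dist.1 hU
  obtain ⟨M, hM0, hM⟩ := hT.exists_nonneg 1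
  obtain ⟨y, hy, hxy⟩ := Metric.mem_closure_iff.1 hx (ε / (M + 1)) (by positivity)
  refine ⟨Set.Iic 1, Iic_mem_nhds one_pos, fun s => T s y,
    (mem_strongContinuitySpace_iff hT0).1 hy, fun s hs => hεU ?_⟩
  rw [lt_div_iff₀ (by positivity)] at hxy
  calc dist (T s x) (T s y) = ‖T s (x - y)‖ := by rw [dist_eq_norm, map_sub]
    _ ≤ M * ‖x - y‖ := hM s hs _
    _ ≤ dist x y * (M + 1) := by
      rw [dist_eq_norm]
      nlinarith [norm_nonneg (x - y)]
    _ < ε := hxy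

/-- Norm continuity of an orbit at `0` propagates to all times. -/
theorem IsLocallyBounded.continuous_orbit (hT : IsLocallyBounded T) (hT0 : ∀ x, T 0 x = x)
    (hTadd : ∀ s h x, T (s + h) x = T s (T h x)) {x : X} (hx : x ∈ strongContinuitySpace T) :
    Continuous fun s => T s x := by
  rw [mem_strongContinuitySpace_iff hT0, ContinuousAt, hT0] at hx
  refine continuous_iff_continuousAt.2 fun s₀ => ?_
  obtain ⟨M, hM0, hM⟩ := hT.exists_nonneg (s₀ + 1)
  -- With truncated subtraction, `(s - s₀) + (s₀ - s)` is the distance of `s` and `s₀`.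
  have hd : Tendsto (fun s : ℝ≥0 => (s - s₀) + (s₀ - s)) (𝓝 s₀) (𝓝 0) := by
    have : Continuous fun s : ℝ≥0 => (s - s₀) + (s₀ - s) := by fun_prop
    simpa using this.tendsto s₀
  have h1 : Tendsto (fun s => M * ‖T ((s - s₀) + (s₀ - s)) x - x‖) (𝓝 s₀) (𝓝 0) := by
    simpa using ((hx.comp hd).sub_const x).norm.const_mul M
  refine tendsto_iff_norm_sub_tendsto_zero.2 (squeeze_zero' (Eventually.of_forall fun _ =>
    norm_nonneg _) ?_ h1)
  filter_upwards [Iic_mem_nhds (lt_add_one s₀)] with s hs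
  rcases le_total s s₀ with h | h
  · rw [tsub_eq_zero_of_le h, zero_add, norm_sub_rev]
    conv_lhs => rw [← add_tsub_cancel_of_le h, hTadd, ← map_sub]
    exact hM s hs _
  · rw [tsub_eq_zero_of_le h, add_zero]
    conv_lhs => rw [← add_tsub_cancel_of_le h, hTadd, ← map_sub]
    exact hM s₀ (le_add_of_nonneg_right zero_le_one) _

/-- The integral means of a norm continuous orbit lie in the domain of the norm generator and
converge to the initial value. -/
theorem IsLocallyBounded.strongContinuitySpace_subset_closure [CompleteSpace X]
    (hT : IsLocallyBounded T) (hT0 : ∀ x, T 0 x = x)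
    (hTadd : ∀ s h x, T (s + h) x = T s (T h x)) :
    strongContinuitySpace T ⊆ closure (generatorDomain (normTopology X) T) := by
  intro f hf
  let _ : NormedSpace ℝ X := NormedSpace.restrictScalars ℝ 𝕜 X
  have hsmul : ∀ (r : ℝ) (x : X), r • x = (r : 𝕜) • x := fun r x => rfl
  have hg : Continuous fun s : ℝ => T s.toNNReal f :=
    (hT.continuous_orbit hT0 hTadd hf).comp continuous_real_toNNReal
  set g : ℝ → X := fun s => T s.toNNReal f with hgdef
  set G : ℝ → X := fun r => ∫ s in (0 : ℝ)..r, g s with hG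
  have hderiv : ∀ r, HasDerivAt G (g r) r := fun r =>
    (hg.integral_hasStrictDerivAt 0 r).hasDerivAt
  have hint : ∀ a b, IntervalIntegrable g MeasureTheory.volume a b := fun a b =>
    hg.intervalIntegrable a b
  have hshift : ∀ (t : ℝ) (h : ℝ≥0), 0 ≤ t → T h (G t) = G (t + h) - G h := by
    intro t h ht
    have h1 := ContinuousLinearMap.intervalIntegral_comp_comm
      (⟨T h, hT.continuous h⟩ : X →L[𝕜] X) (hint 0 t)
    have h2 : ∫ s in (0 : ℝ)..t, T h (g s) = ∫ s in (0 : ℝ)..t, g (s + h) := by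
      refine intervalIntegral.integral_congr fun s hs => ?_
      rw [Set.uIcc_of_le ht] at hs
      simp only [hgdef]
      rw [← hTadd, Real.toNNReal_add hs.1 h.coe_nonneg, Real.toNNReal_coe, add_comm]
    rw [intervalIntegral.integral_comp_add_right, zero_add] at h2
    rw [hG]
    simp only
    rw [intervalIntegral.integral_interval_sub_left (hint _ _) (hint _ _), ← h2]
    exact h1.symm
  -- The generator value of `G t` is `g t - g 0`, because `T h (G t) - G t = G (t + h) - G h - G t`.
  have hdom : ∀ t : ℝ, 0 ≤ t → G t ∈ generatorDomain (normTopology X) T := by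
    intro t ht
    refine ⟨g t - g 0, ?_⟩
    have h1 : HasDerivAt (fun r => G (t + r) - G r) (g t - g 0) 0 := by
      refine HasDerivAt.sub ?_ (hderiv 0)
      have := (hderiv (t + 0)).comp_const_add t 0
      simpa using this
    have h2 := h1.tendsto_slope_zero_right
    have h3 : Tendsto (fun h : ℝ≥0 => (h : ℝ)) (𝓝[>] 0) (𝓝[>] 0) := by
      refine tendsto_nhdsWithin_iff.2 ⟨?_, ?_⟩
      · exact (NNReal.continuous_coe.tendsto' 0 0 rfl).mono_left nhdsWithin_le_nhds
      · filter_upwards [self_mem_nhdsWithin] with h hh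
        exact NNReal.coe_pos.2 hh
    refine (h2.comp h3).congr fun h => ?_
    have hG0 : G 0 = 0 := by simp [hG]
    simp only [Function.comp, zero_add, add_zero, hG0, sub_zero]
    rw [hsmul, hshift t h ht, RCLike.ofReal_inv]
  have hsmem : ∀ (c : 𝕜) (x : X), x ∈ generatorDomain (normTopology X) T →
      c • x ∈ generatorDomain (normTopology X) T := by
    rintro c x ⟨y, hy⟩
    refine ⟨c • y, ?_⟩
    have hy' : Tendsto _ _ (𝓝 y) := hy
    refine (hy'.const_smul c).congr fun s => ?_
    rw [map_smul, ← smul_sub, smul_comm]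
  have hlim : Tendsto (fun t : ℝ => t⁻¹ • G t) (𝓝[>] 0) (𝓝 f) := by
    simpa [hG, hgdef, hT0] using (hderiv 0).tendsto_slope_zero_right
  refine mem_closure_of_tendsto hlim ?_
  filter_upwards [self_mem_nhdsWithin] with t ht
  exact hsmem _ _ (hdom t (le_of_lt ht))

/-- In a reflexive space, a locally bounded semigroup with weakly continuous orbits is norm
strongly continuous: the weak means of an orbit exist by reflexivity, have norm continuous orbits,
and converge weakly to the initial value. -/
theorem IsLocallyBounded.mem_strongContinuitySpace_of_weak (hX : IsReflexiveSpace 𝕜 X)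
    (hT : IsLocallyBounded T) (hT0 : ∀ x, T 0 x = x)
    (hTadd : ∀ s h x, T (s + h) x = T s (T h x)) {f : X}
    (hw : ∀ l : StrongDual 𝕜 X, Continuous fun s => l (T s f)) :
    f ∈ strongContinuitySpace T := by
  have hw' : ∀ l : StrongDual 𝕜 X, Continuous fun s : ℝ => l (T s.toNNReal f) := fun l =>
    (hw l).comp continuous_real_toNNReal
  have hint : ∀ (l : StrongDual 𝕜 X) a b,
      IntervalIntegrable (fun s : ℝ => l (T s.toNNReal f)) MeasureTheory.volume a b :=
    fun l a b => (hw' l).intervalIntegrable a b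
  -- `x t` is the weak integral of the orbit of `f` over `[0, t]`.
  have hx : ∀ t : ℝ≥0, ∃ x : X, ∀ l : StrongDual 𝕜 X,
      l x = ∫ s in (0 : ℝ)..t, l (T s.toNNReal f) := by
    intro t
    obtain ⟨M, hM0, hM⟩ := hT.exists_nonneg t
    let Φ : StrongDual 𝕜 (StrongDual 𝕜 X) := LinearMap.mkContinuous
      { toFun := fun l => ∫ s in (0 : ℝ)..t, l (T s.toNNReal f)
        map_add' := fun a b => intervalIntegral.integral_add (hint a _ _) (hint b _ _)
        map_smul' := fun c a => intervalIntegral.integral_smul c _ } (M * ‖f‖ * t) fun l => by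
          refine (intervalIntegral.norm_integral_le_of_norm_le_const
            (C := ‖l‖ * (M * ‖f‖)) fun s hs => ?_).trans_eq ?_
          · rw [Set.uIoc_of_le t.coe_nonneg] at hs
            refine (l.le_opNorm _).trans ?_
            gcongr
            exact hM _ (Real.toNNReal_le_iff_le_coe.2 hs.2) f
          · rw [sub_zero, abs_of_nonneg t.coe_nonneg]
            ring
    obtain ⟨x, hx⟩ := hX Φ
    exact ⟨x, fun l => congrArg (fun Ψ => Ψ l) hx⟩
  choose x hx using hx
  have hxS : ∀ t, x t ∈ strongContinuitySpace T := by
    intro t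
    rw [mem_strongContinuitySpace_iff hT0, ContinuousAt, hT0]
    obtain ⟨M, hM0, hM⟩ := hT.exists_nonneg (t + 1)
    have hlim : Tendsto (fun h : ℝ≥0 => 2 * (M * ‖f‖) * (h : ℝ)) (𝓝 0) (𝓝 0) := by
      have : Continuous fun h : ℝ≥0 => 2 * (M * ‖f‖) * (h : ℝ) := by fun_prop
      simpa using this.tendsto 0
    refine tendsto_iff_norm_sub_tendsto_zero.2 (squeeze_zero' (Eventually.of_forall fun _ =>
      norm_nonneg _) ?_ hlim)
    filter_upwards [Iic_mem_nhds one_pos] with h hh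
    refine NormedSpace.norm_le_dual_bound 𝕜 _ (by positivity) fun l => ?_
    have h1 : l (T h (x t)) = ∫ s in (h : ℝ)..(t + h), l (T s.toNNReal f) := by
      have h2 := hx t (l.comp (⟨T h, hT.continuous h⟩ : X →L[𝕜] X))
      have h3 : ∫ s in (0 : ℝ)..t, l (T h (T s.toNNReal f))
          = ∫ s in (0 : ℝ)..t, (fun r : ℝ => l (T r.toNNReal f)) (s + h) := by
        refine intervalIntegral.integral_congr fun s hs => ?_
        rw [Set.uIcc_of_le t.coe_nonneg] at hs
        simp only
        rw [← hTadd, Real.toNNReal_add hs.1 h.coe_nonneg, Real.toNNReal_coe, add_comm]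
      rw [intervalIntegral.integral_comp_add_right (fun r : ℝ => l (T r.toNNReal f)),
        zero_add] at h3
      exact h2.trans h3
    have hb : ∀ s : ℝ, s ≤ t + 1 → ‖l (T s.toNNReal f)‖ ≤ ‖l‖ * (M * ‖f‖) := fun s hs => by
      refine (l.le_opNorm _).trans ?_
      gcongr
      exact hM _ (Real.toNNReal_le_iff_le_coe.2 (by simpa using hs)) f
    have hh' : (h : ℝ) ≤ 1 := hh
    have ht0 : (0 : ℝ) ≤ t := t.coe_nonneg
    have hh0 : (0 : ℝ) ≤ h := h.coe_nonneg
    rw [map_sub, h1, hx t l,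
      intervalIntegral.integral_interval_sub_interval_comm (hint _ _ _) (hint _ _ _) (hint _ _ _)]
    refine (norm_sub_le _ _).trans ((add_le_add
      (intervalIntegral.norm_integral_le_of_norm_le_const (C := ‖l‖ * (M * ‖f‖)) ?_)
      (intervalIntegral.norm_integral_le_of_norm_le_const (C := ‖l‖ * (M * ‖f‖)) ?_)).trans_eq ?_)
    · intro s hs
      rw [Set.uIoc_comm, Set.uIoc_of_le hh0] at hs
      exact hb s (by linarith [hs.2])
    · intro s hs
      rw [Set.uIoc_comm, Set.uIoc_of_le (by linarith)] at hs
      exact hb s (by linarith [hs.2])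
    · rw [zero_sub, abs_neg, abs_of_nonneg hh0, sub_add_cancel_left, abs_neg, abs_of_nonneg hh0]
      ring
  by_contra hf
  obtain ⟨l, hlf, hl⟩ := exists_dual_ne_zero_of_notMem (strongContinuitySubmodule hT0)
    (hT.isClosed_strongContinuitySpace hT0) (x := f) hf
  -- `l` annihilates all weak means, hence also their weak limit `f`.
  have hd := ((hw' l).integral_hasStrictDerivAt 0 0).hasDerivAt.tendsto_slope_zero_right
  refine hlf (tendsto_nhds_unique (f := fun _ : ℝ => (0 : 𝕜)) (l := 𝓝[>] (0 : ℝ)) ?_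
    tendsto_const_nhds)
  rw [Real.toNNReal_zero, hT0] at hd
  refine hd.congr' ?_
  filter_upwards [self_mem_nhdsWithin] with t ht
  have h0 := hx t.toNNReal l
  rw [hl _ (hxS _), Real.coe_toNNReal t (le_of_lt ht)] at h0
  simp [← h0]

variable {τ : TopologicalSpace X}

/-- If `f` has `τ`-generator value `g`, then `‖T t f - f‖ ≤ M ‖g‖ t` near `0`, so that the orbit of
`f` is norm continuous at `0`. -/
theorem IsLocallyBounded.generatorDomain_subset (hT : IsLocallyBounded T) (h : IsSaks 𝕜 τ)
    (hT0 : ∀ x, T 0 x = x) (hTadd : ∀ s h x, T (s + h) x = T s (T h x))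
    (hTτ : IsStronglyContinuous τ T) : generatorDomain τ T ⊆ strongContinuitySpace T := by
  rintro f ⟨g, hfg⟩
  obtain ⟨M, hM0, hM⟩ := hT.exists_nonneg 1
  have hlim : Tendsto (fun t : ℝ≥0 => M * ‖g‖ * (t : ℝ)) (𝓝[>] 0) (𝓝 0) := by
    have : Continuous fun t : ℝ≥0 => M * ‖g‖ * (t : ℝ) := by fun_prop
    simpa using (this.tendsto 0).mono_left nhdsWithin_le_nhds
  refine tendsto_iff_norm_sub_tendsto_zero.2 (squeeze_zero' (Eventually.of_forall fun _ =>
    norm_nonneg _) ?_ hlim)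
  filter_upwards [Ioo_mem_nhdsGT one_pos] with t ht
  simpa using h.norm_orbit_sub_le hT0 hTadd hTτ hfg (t := t) (c := 0) (ε := M * ‖g‖)
    fun s hs => by simpa using hM s (hs.le.trans ht.2.le) g

end LocallyBounded

/-! ### Weighted composition semigroups -/

section WeightedComposition

variable {𝕜 : Type*} [RCLike 𝕜] {Ω : Type*} [TopologicalSpace Ω] {F : Type*}
  [NormedAddCommGroup F] [NormedSpace 𝕜 F] {ι : F →ₗ[𝕜] C(Ω, 𝕜)} (hι : Function.Injective ι)
  {m : ℝ≥0 → Ω → 𝕜} {φ : ℝ≥0 → Ω → Ω} (h : IsCoSemiflowFor ι m φ)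

/-- Multiplication by a fixed function is continuous for the compact-open topology on `C(Ω, 𝕜)`,
without local compactness of `Ω`: the topology is determined by restrictions to compact sets. -/
theorem continuous_mul_left_compactOpen [T2Space Ω] (a : C(Ω, 𝕜)) :
    Continuous fun g : C(Ω, 𝕜) => a * g := by
  refine continuous_iff_continuousAt.2 fun g =>
    (ContinuousMap.tendsto_compactOpen_iff_forall _ _).2 fun K hK => ?_
  have : CompactSpace K := isCompact_iff_compactSpace.1 hK
  have hc : Continuous fun g : C(Ω, 𝕜) => a.restrict K * g.restrict K :=
    continuous_const.mul (ContinuousMap.continuous_restrict K)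
  exact hc.tendsto g

theorem weightedComp_zero (f : F) : weightedComp hι h 0 f = f :=
  hι <| ContinuousMap.ext fun x => by
    rw [weightedComp_apply, h.semicocycle.zero, h.semiflow.zero, one_mul]

theorem weightedComp_add (s t : ℝ≥0) (f : F) :
    weightedComp hι h (s + t) f = weightedComp hι h s (weightedComp hι h t f) :=
  hι <| ContinuousMap.ext fun x => by
    rw [weightedComp_apply, weightedComp_apply, weightedComp_apply, h.semicocycle.add,
      add_comm s t, h.semiflow.add, mul_assoc]

theorem isStronglyContinuous_compactOpen_weightedComp [T2Space Ω] (hj : IsJointlyContinuous m φ) :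
    IsStronglyContinuous (compactOpenTopology ι) (weightedComp hι h) := by
  refine ⟨fun s => continuous_induced_rng.2 ?_, fun f => continuous_induced_rng.2 ?_⟩
  · let mc : C(Ω, 𝕜) := ⟨m s, h.semicocycle.continuous s⟩
    let φc : C(Ω, Ω) := ⟨φ s, h.semiflow.continuous s⟩
    have h1 : (ι ∘ weightedComp hι h s) = (fun g : C(Ω, 𝕜) => mc * g.comp φc) ∘ ι := by
      funext f
      ext x
      exact weightedComp_apply hι h s f x
    have h2 : Continuous fun g : C(Ω, 𝕜) => mc * g.comp φc :=
      (continuous_mul_left_compactOpen mc).comp (ContinuousMap.continuous_precomp φc)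
    rw [h1]
    exact @Continuous.comp _ _ _ (compactOpenTopology ι) _ _ _ _ h2 continuous_induced_dom
  · let c : C(ℝ≥0 × Ω, 𝕜) := ⟨fun p => m p.1 p.2 * ι f (φ p.1 p.2),
      hj.semicocycle.mul ((ι f).continuous.comp hj.semiflow)⟩
    have h1 : (ι ∘ fun s => weightedComp hι h s f) = c.curry := by
      funext s
      ext x
      exact weightedComp_apply hι h s f x
    rw [h1]
    exact c.curry.continuous

/-- Point evaluation, as a norm continuous functional. -/
def evalDual (hc : normTopology F ≤ compactOpenTopology ι) (x : Ω) : StrongDual 𝕜 F where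
  toFun f := ι f x
  map_add' f g := by simp
  map_smul' c f := by simp
  cont := (continuous_eval_const (F := C(Ω, 𝕜)) x).comp (continuous_le_dom hc continuous_induced_dom)

end WeightedComposition

end Saks

theorem mainTheorem6 {𝕜 : Type*} [RCLike 𝕜] {Ω : Type*} [TopologicalSpace Ω] [T2Space Ω]
    {F : Type*} [NormedAddCommGroup F] [NormedSpace 𝕜 F]
    (ι : F →ₗ[𝕜] C(Ω, 𝕜)) (hι : Function.Injective ι)
    (hSaks : Saks.IsSaks 𝕜 (Saks.compactOpenTopology ι))
    (hcomplete : Saks.IsSeqComplete (Saks.gammaTopology ι))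
    (m : ℝ≥0 → Ω → 𝕜) (φ : ℝ≥0 → Ω → Ω)
    (hmφ : Saks.IsCoSemiflowFor ι m φ) (hjoint : Saks.IsJointlyContinuous m φ) :
    (Saks.IsStronglyContinuous (Saks.normTopology F) (Saks.weightedComp hι hmφ) →
      Saks.generatorDomain (Saks.gammaTopology ι) (Saks.weightedComp hι hmφ) =
        Saks.generatorDomain (Saks.normTopology F) (Saks.weightedComp hι hmφ) ∧
      ∀ (f : F)
        (hf : f ∈ Saks.generatorDomain (Saks.gammaTopology ι) (Saks.weightedComp hι hmφ))
        (hf' : f ∈ Saks.generatorDomain (Saks.normTopology F) (Saks.weightedComp hι hmφ)),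
        Saks.generator (Saks.gammaTopology ι) (Saks.weightedComp hι hmφ) ⟨f, hf⟩ =
          Saks.generator (Saks.normTopology F) (Saks.weightedComp hι hmφ) ⟨f, hf'⟩) ∧
    (Saks.IsReflexiveSpace 𝕜 F → Saks.IsLocallyBounded (Saks.weightedComp hι hmφ) →
      Saks.IsStronglyContinuous (Saks.normTopology F) (Saks.weightedComp hι hmφ)) ∧
    (Saks.IsLocallyBounded (Saks.weightedComp hι hmφ) →
      Saks.strongContinuitySpace (Saks.weightedComp hι hmφ) =
        @closure F (Saks.normTopology F)
          (Saks.generatorDomain (Saks.gammaTopology ι) (Saks.weightedComp hι hmφ))) := by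
  have hT0 := Saks.weightedComp_zero hι hmφ
  have hTadd := Saks.weightedComp_add hι hmφ
  have hTco := Saks.isStronglyContinuous_compactOpen_weightedComp hι hmφ hjoint
  obtain ⟨-, -, hnγ, hγco⟩ := (Saks.isLeast_mixedTopology hSaks.toIsPreSaks).1
  refine ⟨fun hT => ?_, fun hrefl hT => ?_, fun hT => ?_⟩
  · refine ⟨Set.Subset.antisymm ?_ ?_, fun f hf hf' => ?_⟩
    · rintro f ⟨g, hfg⟩
      refine ⟨g, hSaks.hasGeneratorValue_norm hT0 hTadd hTco (hfg.mono hγco) ?_⟩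
      have : Continuous fun s => Saks.weightedComp hι hmφ s g := hT.2 g
      exact (Saks.mem_strongContinuitySpace_iff hT0).2 this.continuousAt
    · rintro f ⟨g, hfg⟩
      exact ⟨g, hfg.mono hnγ⟩
    · refine (Saks.generator_eq_iff (Saks.t2Space_mixedTopology hSaks.toIsPreSaks) _ _).2 ?_
      exact Saks.HasGeneratorValue.mono hnγ hf'.choose_spec
  · refine ⟨hT.continuous, fun f => hT.continuous_orbit hT0 hTadd
      (hT.mem_strongContinuitySpace_of_weak hrefl hT0 hTadd
        (hrefl.continuous_dual_apply (D := Set.range (Saks.evalDual hSaks.coarser)) ?_ ?_ ?_))⟩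
    · intro g hg
      refine hι (ContinuousMap.ext fun x => ?_)
      rw [map_zero]
      exact hg _ ⟨x, rfl⟩
    · intro s
      obtain ⟨M, hM⟩ := hT (s + 1)
      refine ⟨M * ‖f‖, ?_⟩
      filter_upwards [Iic_mem_nhds (lt_add_one s)] with r hr
      exact hM r hr f
    · rintro _ ⟨x, rfl⟩
      have h1 : Continuous fun s => m s x * ι f (φ s x) :=
        (hjoint.semicocycle.comp (.prodMk_left x)).mul
          ((ι f).continuous.comp (hjoint.semiflow.comp (.prodMk_left x)))
      exact h1.congr fun s => (Saks.weightedComp_apply hι hmφ s f x).symm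
  · have := hSaks.completeSpace hnγ hγco hcomplete
    refine Set.Subset.antisymm ?_ ?_
    · refine (hT.strongContinuitySpace_subset_closure hT0 hTadd).trans (closure_mono ?_)
      rintro f ⟨g, hfg⟩
      exact ⟨g, hfg.mono hnγ⟩
    · refine closure_minimal ?_ (hT.isClosed_strongContinuitySpace hT0)
      rintro f ⟨g, hfg⟩
      exact hT.generatorDomain_subset hSaks hT0 hTadd hTco ⟨g, hfg.mono hγco⟩
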